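/- Let $\alpha=1$ or $\alpha=\infty$, let $m$ be Lebesgue measure on $[0,\alpha)$, and let $L^0$ be the space of (classes modulo a.e. equality of) a.e. finite real measurable functions on $[0,\alpha)$. For $x\in L^0$ put $d_x(\lambda)=m\{s\in[0,\alpha):|x(s)|>\lambda\}$ and $x^*(t)=\inf\{\lambda>0:d_x(\lambda)\le t\}$. Let $\varphi:[0,\alpha)\to\mathbb{R}$ be concave and nondecreasing with $\varphi(0^+)=0$, put $$\|x\|_{\Lambda_\varphi}=\int_0^\alpha x^*(t)\,\varphi'(t)\,dt\in[0,\infty],$$ and let $\Lambda_\varphi=\{x\in L^0:\|x\|_{\Lambda_\varphi}<\infty\}$. Let $C\subset\Lambda_\varphi$ be nonempty and $\mu$-compact, that is, every sequence in $C$ has a subsequence converging (globally) in the measure $m$ to an element of $C$. Let $x\in\Lambda_\varphi\setminus C$ and let $(c_n)\subset C$ be a minimizing sequence, that is, $\|x-c_n\|_{\Lambda_\varphi}\to\operatorname{dist}(x,C):=\inf_{d\in C}\|x-d\|_{\Lambda_\varphi}$. Then there exist a subsequence $(c_{n_k})$ and a best approximant $c\in C$ of $x$, i.e. $\|x-c\|_{\Lambda_\varphi}=\operatorname{dist}(x,C)$,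 such that $\|c_{n_k}-c\|_{\Lambda_\varphi}\to 0$. -/

import Mathlib

open MeasureTheory Filter Topology
open scoped ENNReal NNReal

noncomputable section

namespace LorentzPhi

/-- The interval `[0, α)` of the real line, where `0 ≤ α ≤ ∞`. -/
def dom (α : ℝ≥0∞) : Set ℝ := {t : ℝ | 0 ≤ t ∧ ENNReal.ofReal t < α}

/-- Lebesgue measure on `[0, α)`. -/
def leb (α : ℝ≥0∞) : Measure ℝ := volume.restrict (dom α)

/-- The space `L⁰` of measurable real functions on `[0, α)`, modulo equality
almost everywhere. -/
abbrev L0 (α : ℝ≥0∞) : Type := ℝ →ₘ[leb α] ℝ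

/-- The distribution function `d_x(l) = m {s ∈ [0, α) : |x(s)| > l}`. -/
def distribution {α : ℝ≥0∞} (x : L0 α) (l : ℝ≥0) : ℝ≥0∞ :=
  leb α {s : ℝ | (l : ℝ) < |x s|}

/-- The decreasing rearrangement `x*(t) = inf {l > 0 : d_x(l) ≤ t}`, with values in `[0, ∞]`
(the infimum of the empty set is `∞`). -/
def rearrangement {α : ℝ≥0∞} (x : L0 α) (t : ℝ) : ℝ≥0∞ :=
  ⨅ (l : ℝ≥0) (_ : 0 < l ∧ distribution x l ≤ ENNReal.ofReal t), (l : ℝ≥0∞)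

/-- The Lorentz functional `‖x‖ = ∫₀^α x*(t) φ'(t) dt`, with values in `[0, ∞]`. For a concave
nondecreasing `φ` the derivative exists and is nonnegative almost everywhere on `[0, α)`. -/
def lorentzNorm {α : ℝ≥0∞} (φ : ℝ → ℝ) (x : L0 α) : ℝ≥0∞ :=
  ∫⁻ t in dom α, rearrangement x t * ENNReal.ofReal (deriv φ t)

/-- The Lorentz space `Λ_φ` of all `x ∈ L⁰` with `‖x‖ < ∞`. -/
def lorentzSpace (α : ℝ≥0∞) (φ : ℝ → ℝ) : Set (L0 α) :=
  {x | lorentzNorm φ x < ∞}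

/-- A set is `μ`-compact if it is nonempty and each of its sequences has a subsequence that
converges (globally) in measure to an element of the set. -/
def IsMuCompact {α : ℝ≥0∞} (C : Set (L0 α)) : Prop :=
  C.Nonempty ∧ ∀ c : ℕ → L0 α, (∀ n, c n ∈ C) →
    ∃ (n : ℕ → ℕ) (c' : L0 α), StrictMono n ∧ c' ∈ C ∧
      TendstoInMeasure (leb α) (fun k => (c (n k) : ℝ → ℝ)) atTop (c' : ℝ → ℝ)

/-- `dist(x, C) = inf {‖x - d‖ : d ∈ C}` for the Lorentz norm. -/
def lorentzDist {α : ℝ≥0∞} (φ : ℝ → ℝ) (x : L0 α) (C : Set (L0 α)) : ℝ≥0∞ :=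
  ⨅ d ∈ C, lorentzNorm φ (x - d)

/-- The set `P_C(x)` of best approximants of `x` in `C`. -/
def bestApproximants {α : ℝ≥0∞} (φ : ℝ → ℝ) (C : Set (L0 α)) (x : L0 α) : Set (L0 α) :=
  {y | y ∈ C ∧ lorentzNorm φ (x - y) = lorentzDist φ x C}

end LorentzPhi

end

open MeasureTheory Filter Topology
open scoped ENNReal NNReal

noncomputable section

namespace LorentzPhi

variable {α : ℝ≥0∞} {φ : ℝ → ℝ}

/-! By `μ`-compactness, a subsequence of `c n` converges in measure to some `c'` in `C`. Then the
rearrangements of `x - c (n k)` converge almost everywhere to that of `x - c'`, and Fatou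
(`lorentzNorm_le_liminf`) makes `c'` a best approximant, so the norms converge too. The Kadec–Klee
property (`tendsto_lorentzNorm_sub`) upgrades this to norm convergence. No triangle inequality is
needed: `(y - z)*(2s) ≤ y*(s) + z*(s)` and, by concavity, `φ'(2s) ≤ φ'(s)`. After the substitution
`t = 2s`, the integrand of `y - z` is thus dominated by the sum of those of `y` and `z`, and Pratt's
theorem applies. -/

lemma measurableSet_dom (α : ℝ≥0∞) : MeasurableSet (dom α) :=
  measurableSet_Ici.inter (measurableSet_lt ENNReal.measurable_ofReal measurable_const)

lemma dom_mem_nhds {t : ℝ} (ht : 0 < t) (h : t ∈ dom α) : dom α ∈ 𝓝 t := by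
  have h1 : ∀ᶠ s in 𝓝 t, ENNReal.ofReal s < α :=
    ENNReal.continuous_ofReal.continuousAt.eventually_lt_const h.2
  filter_upwards [h1, lt_mem_nhds ht] with s hs hs0 using ⟨hs0.le, hs⟩

lemma mem_dom_of_two_mul_mem {s : ℝ} (h : 2 * s ∈ dom α) : s ∈ dom α := by
  have h0 : 0 ≤ s := by linarith [h.1]
  exact ⟨h0, (ENNReal.ofReal_le_ofReal (by linarith)).trans_lt h.2⟩

lemma ae_dom_pos (α : ℝ≥0∞) : ∀ᵐ t ∂volume.restrict (dom α), 0 < t := by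
  have h0 : ∀ᵐ t ∂volume.restrict (dom α), t ≠ 0 :=
    ae_restrict_of_ae (by simp [ae_iff])
  filter_upwards [ae_restrict_mem (measurableSet_dom α), h0] with t ht ht0
  exact lt_of_le_of_ne ht.1 (Ne.symm ht0)

/-! ### The decreasing rearrangement -/

lemma rearrangement_antitone (x : L0 α) : Antitone (rearrangement x) := by
  intro s t hst
  refine le_iInf₂ fun l hl => iInf₂_le l ⟨hl.1, hl.2.trans (ENNReal.ofReal_le_ofReal hst)⟩

lemma exists_of_rearrangement_lt {x : L0 α} {t : ℝ} {a : ℝ≥0∞} (h : rearrangement x t < a) :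
    ∃ l : ℝ≥0, (0 < l ∧ distribution x l ≤ ENNReal.ofReal t) ∧ (l : ℝ≥0∞) < a := by
  simpa only [rearrangement, iInf_lt_iff, exists_prop] using h

lemma distribution_add_le {x y z : L0 α} (h : ∀ᵐ s ∂leb α, |z s| ≤ |x s| + |y s|) (l r : ℝ≥0) :
    distribution z (l + r) ≤ distribution x l + distribution y r := by
  refine (measure_mono_ae ?_).trans (measure_union_le _ _)
  filter_upwards [h] with s hs hz
  change ((l + r : ℝ≥0) : ℝ) < |z s| at hz
  change (l : ℝ) < |x s| ∨ (r : ℝ) < |y s|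
  by_contra! hcon
  push_cast at hz
  linarith [hcon.1, hcon.2]

lemma rearrangement_add_le {x y z : L0 α} (h : ∀ᵐ s ∂leb α, |z s| ≤ |x s| + |y s|)
    {s t : ℝ} (hs : 0 ≤ s) (ht : 0 ≤ t) :
    rearrangement z (s + t) ≤ rearrangement x s + rearrangement y t := by
  refine ENNReal.le_of_forall_pos_le_add fun ε hε hfin => ?_
  have hε2 : (0 : ℝ≥0∞) < ((ε / 2 : ℝ≥0) : ℝ≥0∞) := by exact_mod_cast half_pos hε
  obtain ⟨hx, hy⟩ := ENNReal.add_lt_top.1 hfin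
  obtain ⟨l, hl, hlx⟩ := exists_of_rearrangement_lt (ENNReal.lt_add_right hx.ne hε2.ne')
  obtain ⟨r, hr, hry⟩ := exists_of_rearrangement_lt (ENNReal.lt_add_right hy.ne hε2.ne')
  calc rearrangement z (s + t) ≤ ((l + r : ℝ≥0) : ℝ≥0∞) := by
        refine iInf₂_le (l + r) ⟨add_pos hl.1 hr.1, (distribution_add_le h l r).trans ?_⟩
        rw [ENNReal.ofReal_add hs ht]
        exact add_le_add hl.2 hr.2
    _ ≤ (rearrangement x s + (ε / 2 : ℝ≥0)) + (rearrangement y t + (ε / 2 : ℝ≥0)) := by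
        rw [ENNReal.coe_add]
        exact add_le_add hlx.le hry.le
    _ = rearrangement x s + rearrangement y t + ε := by
        rw [add_add_add_comm, ← ENNReal.coe_add, add_halves]

lemma rearrangement_congr_abs {x y : L0 α} (h : ∀ᵐ s ∂leb α, |x s| = |y s|) :
    rearrangement x = rearrangement y := by
  have hd : distribution x = distribution y := by
    funext l
    refine measure_congr ?_
    filter_upwards [h] with s hs
    change ((l : ℝ) < |x s|) = ((l : ℝ) < |y s|)
    rw [hs]
  funext t
  simp only [rearrangement, hd]

lemma tendsto_rearrangement_sub_of_tendstoInMeasure {y : ℕ → L0 α} {z : L0 α}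
    (h : TendstoInMeasure (leb α) (fun k => (y k : ℝ → ℝ)) atTop (z : ℝ → ℝ))
    {t : ℝ} (ht : 0 < t) :
    Tendsto (fun k => rearrangement (y k - z) t) atTop (𝓝 0) := by
  rw [ENNReal.tendsto_nhds_zero]
  intro ε hε
  obtain ⟨δ, hδ0, hδ⟩ := ENNReal.lt_iff_exists_nnreal_btwn.1 hε
  have hδpos : 0 < δ := by exact_mod_cast hδ0
  filter_upwards [(h δ hδ0).eventually_lt_const (ENNReal.ofReal_pos.2 ht)] with k hk
  refine (iInf₂_le δ ⟨hδpos, le_trans (measure_mono_ae ?_) hk.le⟩).trans hδ.le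
  filter_upwards [AEEqFun.coeFn_sub (y k) z] with s hs hlt
  change (δ : ℝ) < |(y k - z : L0 α) s| at hlt
  change (δ : ℝ≥0∞) ≤ edist (y k s) (z s)
  rw [hs, Pi.sub_apply, ← Real.dist_eq] at hlt
  rw [edist_dist, ← ENNReal.ofReal_coe_nnreal]
  exact ENNReal.ofReal_le_ofReal hlt.le

lemma ae_abs_le_add_abs_sub (x y : L0 α) :
    ∀ᵐ s ∂leb α, |x s| ≤ |y s| + |(x - y : L0 α) s| := by
  filter_upwards [AEEqFun.coeFn_sub x y] with s hs
  rw [hs, Pi.sub_apply]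
  calc |x s| = |y s + (x s - y s)| := by ring_nf
    _ ≤ _ := abs_add_le _ _

lemma ae_abs_sub_comm (x y : L0 α) :
    ∀ᵐ s ∂leb α, |(x - y : L0 α) s| = |(y - x : L0 α) s| := by
  filter_upwards [AEEqFun.coeFn_sub x y, AEEqFun.coeFn_sub y x] with s h1 h2
  rw [h1, h2, Pi.sub_apply, Pi.sub_apply, abs_sub_comm]

lemma ae_abs_sub_le (x y : L0 α) :
    ∀ᵐ s ∂leb α, |(x - y : L0 α) s| ≤ |x s| + |y s| := by
  filter_upwards [AEEqFun.coeFn_sub x y] with s hs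
  rw [hs, Pi.sub_apply]
  exact abs_sub _ _

/-- Subadditivity compares `y k` and `z` at arguments differing by a small gap, on which the
rearrangement of `y k - z` tends to zero; continuity of `z*` at `t` absorbs the gap. -/
lemma tendsto_rearrangement {y : ℕ → L0 α} {z : L0 α}
    (h : ∀ s, 0 < s → Tendsto (fun k => rearrangement (y k - z) s) atTop (𝓝 0))
    {t : ℝ} (ht : 0 < t) (hc : ContinuousAt (rearrangement z) t) :
    Tendsto (fun k => rearrangement (y k) t) atTop (𝓝 (rearrangement z t)) := by
  rw [tendsto_order]
  constructor
  · intro a ha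
    have h1 : ∀ᶠ s in 𝓝[>] t, a < rearrangement z s :=
      (hc.eventually_const_lt ha).filter_mono nhdsWithin_le_nhds
    obtain ⟨s, hs, hts⟩ := (h1.and self_mem_nhdsWithin).exists
    have hts' : 0 < s - t := sub_pos.2 hts
    filter_upwards [(h _ hts').eventually_lt_const (tsub_pos_of_lt hs)] with k hk
    by_contra! hle
    have h2 : rearrangement z s ≤ rearrangement (y k) t + rearrangement (y k - z) (s - t) := by
      have h3 := rearrangement_add_le (ae_abs_le_add_abs_sub z (y k)) ht.le hts'.le
      rwa [add_sub_cancel, rearrangement_congr_abs (ae_abs_sub_comm z (y k))] at h3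
    refine absurd (h2.trans_lt ?_) (lt_irrefl _)
    calc rearrangement (y k) t + rearrangement (y k - z) (s - t)
        ≤ a + rearrangement (y k - z) (s - t) := by gcongr
      _ < a + (rearrangement z s - a) := ENNReal.add_lt_add_left ha.ne_top hk
      _ = rearrangement z s := add_tsub_cancel_of_le hs.le
  · intro b hb
    have h1 : ∀ᶠ s in 𝓝[<] t, rearrangement z s < b :=
      (hc.eventually_lt_const hb).filter_mono nhdsWithin_le_nhds
    have h0 : ∀ᶠ s in 𝓝[<] t, 0 < s := (lt_mem_nhds ht).filter_mono nhdsWithin_le_nhds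
    obtain ⟨s, ⟨hs, hs0⟩, hst⟩ := ((h1.and h0).and self_mem_nhdsWithin).exists
    have hst' : 0 < t - s := sub_pos.2 hst
    have hlim := (h _ hst').const_add (rearrangement z s)
    rw [add_zero] at hlim
    filter_upwards [hlim.eventually_lt_const hs] with k hk
    have h3 := rearrangement_add_le (ae_abs_le_add_abs_sub (y k) z) hs0.le hst'.le
    rw [add_sub_cancel] at h3
    exact h3.trans_lt hk

/-! ### The Lorentz functional -/

/-- The integrand `x*(t) φ'(t)` of the Lorentz functional. -/
def integrand (φ : ℝ → ℝ) (x : L0 α) (t : ℝ) : ℝ≥0∞ :=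
  rearrangement x t * ENNReal.ofReal (deriv φ t)

lemma measurable_integrand (φ : ℝ → ℝ) (x : L0 α) : Measurable (integrand φ x) :=
  (rearrangement_antitone x).measurable.mul (measurable_deriv φ).ennreal_ofReal

lemma ae_tendsto_integrand (φ : ℝ → ℝ) {y : ℕ → L0 α} {z : L0 α}
    (h : ∀ s, 0 < s → Tendsto (fun k => rearrangement (y k - z) s) atTop (𝓝 0)) :
    ∀ᵐ t ∂volume.restrict (dom α),
      Tendsto (fun k => integrand φ (y k) t) atTop (𝓝 (integrand φ z t)) := by
  have hc : ∀ᵐ t ∂volume.restrict (dom α), ContinuousAt (rearrangement z) t := by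
    refine ae_restrict_of_ae ?_
    filter_upwards [(rearrangement_antitone z).countable_not_continuousAt.ae_notMem volume]
      with t ht
    simpa using ht
  filter_upwards [hc, ae_dom_pos α] with t ht ht0
  exact ENNReal.Tendsto.mul_const (tendsto_rearrangement h ht0 ht) (Or.inr ENNReal.ofReal_ne_top)

lemma lorentzNorm_le_liminf (φ : ℝ → ℝ) {y : ℕ → L0 α} {z : L0 α}
    (h : ∀ s, 0 < s → Tendsto (fun k => rearrangement (y k - z) s) atTop (𝓝 0)) :
    lorentzNorm φ z ≤ liminf (fun k => lorentzNorm φ (y k)) atTop := by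
  refine le_trans (lintegral_mono_ae ?_)
    (lintegral_liminf_le fun k => measurable_integrand φ (y k))
  filter_upwards [ae_tendsto_integrand φ h] with t ht
  exact ht.liminf_eq.ge

/-- The slope of `φ` over `[s, 2s]` separates the two derivatives. -/
lemma ae_deriv_two_mul_le (hconc : ConcaveOn ℝ (dom α) φ) (hmono : MonotoneOn φ (dom α)) :
    ∀ᵐ s ∂volume.restrict (dom α), 2 * s ∈ dom α →
      ENNReal.ofReal (deriv φ (2 * s)) ≤ ENNReal.ofReal (deriv φ s) := by
  filter_upwards [ae_dom_pos α, ae_restrict_mem (measurableSet_dom α),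
    hmono.ae_differentiableWithinAt (measurableSet_dom α)] with s hs0 hs hdiff h2s
  by_cases hd : DifferentiableAt ℝ φ (2 * s)
  · refine ENNReal.ofReal_le_ofReal ((hconc.deriv_le_slope hs h2s (by linarith) hd).trans ?_)
    exact hconc.slope_le_deriv hs h2s (by linarith) (hdiff.differentiableAt (dom_mem_nhds hs0 hs))
  -- The default value zero of `deriv` spares an almost-everywhere argument at `2 * s`.
  · simp [deriv_zero_of_not_differentiableAt hd]

/-- The integrand of the Lorentz functional, extended by zero and dilated by the factor `2`. -/
def dilatedIntegrand (φ : ℝ → ℝ) (x : L0 α) (s : ℝ) : ℝ≥0∞ :=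
  (dom α).indicator (integrand φ x) (2 * s)

lemma measurable_dilatedIntegrand (φ : ℝ → ℝ) (x : L0 α) : Measurable (dilatedIntegrand φ x) :=
  ((measurable_integrand φ x).indicator (measurableSet_dom α)).comp (measurable_const_mul 2)

lemma lorentzNorm_eq_dilated (φ : ℝ → ℝ) (x : L0 α) :
    lorentzNorm φ x = 2 * ∫⁻ s in dom α, dilatedIntegrand φ x s := by
  have hm := (measurable_integrand φ x).indicator (measurableSet_dom α)
  have h1 : lorentzNorm φ x = ∫⁻ t, (dom α).indicator (integrand φ x) t :=
    (lintegral_indicator (measurableSet_dom α) _).symm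
  have h2 : (dom α).indicator (dilatedIntegrand φ x) = dilatedIntegrand φ x := by
    rw [Set.indicator_eq_self]
    intro s hs
    by_contra hsd
    exact hs (Set.indicator_of_notMem (fun h => hsd (mem_dom_of_two_mul_mem h)) _)
  have h3 : ∀ f : ℝ → ℝ≥0∞, Measurable f → ∫⁻ t, f t = 2 * ∫⁻ s, f (2 * s) := fun f hf => by
    conv_lhs => rw [← Real.smul_map_volume_mul_left (two_ne_zero' ℝ)]
    rw [lintegral_smul_measure, lintegral_map hf (measurable_const_mul 2)]
    simp
  rw [h1, ← lintegral_indicator (measurableSet_dom α), h2, h3 _ hm]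
  rfl

/-- The exceptional null set depends on `φ` alone, hence the functions are quantified inside. -/
lemma ae_dilatedIntegrand_le (hconc : ConcaveOn ℝ (dom α) φ) (hmono : MonotoneOn φ (dom α)) :
    ∀ᵐ s ∂volume.restrict (dom α), ∀ x y z : L0 α, (∀ᵐ s ∂leb α, |z s| ≤ |x s| + |y s|) →
      dilatedIntegrand φ z s ≤ integrand φ x s + integrand φ y s := by
  filter_upwards [ae_deriv_two_mul_le hconc hmono, ae_dom_pos α] with s hs hs0 x y z h
  by_cases h2s : 2 * s ∈ dom α
  · rw [dilatedIntegrand, Set.indicator_of_mem h2s, integrand, integrand, integrand, ← add_mul]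
    refine mul_le_mul' ?_ (hs h2s)
    rw [two_mul]
    exact rearrangement_add_le h hs0.le hs0.le
  · rw [dilatedIntegrand, Set.indicator_of_notMem h2s]
    exact zero_le

lemma lorentzNorm_sub_lt_top (hconc : ConcaveOn ℝ (dom α) φ) (hmono : MonotoneOn φ (dom α))
    {x y : L0 α} (hx : lorentzNorm φ x < ∞) (hy : lorentzNorm φ y < ∞) :
    lorentzNorm φ (x - y) < ∞ := by
  rw [lorentzNorm_eq_dilated]
  refine ENNReal.mul_lt_top ENNReal.ofNat_lt_top ?_
  refine (lintegral_mono_ae ((ae_dilatedIntegrand_le hconc hmono).mono fun s hs =>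
    hs x y _ (ae_abs_sub_le x y))).trans_lt ?_
  rw [lintegral_add_left (measurable_integrand φ x)]
  exact ENNReal.add_lt_top.2 ⟨hx, hy⟩

end LorentzPhi

/-- Pratt's form of the dominated convergence theorem: the dominating functions may vary, if
their integrals converge to the integral of their limit. -/
lemma tendsto_lintegral_zero_of_le_add {X : Type*} [MeasurableSpace X] {μ : Measure X}
    {h F : ℕ → X → ℝ≥0∞} {G : X → ℝ≥0∞} (hm : ∀ k, Measurable (h k)) (hF : ∀ k, Measurable (F k))
    (hG : Measurable G) (hle : ∀ k, ∀ᵐ a ∂μ, h k a ≤ F k a + G a)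
    (hlim : ∀ᵐ a ∂μ, Tendsto (fun k => h k a) atTop (𝓝 0))
    (hFlim : ∀ᵐ a ∂μ, Tendsto (fun k => F k a) atTop (𝓝 (G a)))
    (hGfin : ∫⁻ a, G a ∂μ ≠ ∞)
    (hint : Tendsto (fun k => ∫⁻ a, F k a ∂μ) atTop (𝓝 (∫⁻ a, G a ∂μ))) :
    Tendsto (fun k => ∫⁻ a, h k a ∂μ) atTop (𝓝 0) := by
  have hGae : ∀ᵐ a ∂μ, G a < ∞ := ae_lt_top hG hGfin
  have h1 : Tendsto (fun k => ∫⁻ a, (G a - F k a) ∂μ) atTop (𝓝 0) := by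
    have := tendsto_lintegral_of_dominated_convergence (μ := μ) (F := fun k a => G a - F k a)
      (f := fun _ => 0) G (fun k => hG.sub (hF k)) (fun k => ae_of_all _ fun a => tsub_le_self)
      hGfin ?_
    · simpa using this
    · filter_upwards [hFlim, hGae] with a ha hfin
      simpa using ENNReal.Tendsto.sub (tendsto_const_nhds (x := G a)) ha (Or.inl hfin.ne)
  -- Subtraction is truncated, so `(F - G) + G = max F G = F + (G - F)`; convergence of the
  -- integrals transfers `h1` to the other side.
  have h2 : Tendsto (fun k => ∫⁻ a, (F k a - G a) ∂μ) atTop (𝓝 0) := by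
    have heq : ∀ k, ∫⁻ a, (F k a - G a) ∂μ =
        (∫⁻ a, F k a ∂μ + ∫⁻ a, (G a - F k a) ∂μ) - ∫⁻ a, G a ∂μ := by
      intro k
      refine ENNReal.eq_sub_of_add_eq hGfin ?_
      rw [← lintegral_add_right _ hG, ← lintegral_add_left (hF k)]
      refine lintegral_congr fun a => ?_
      rw [tsub_add_eq_max, add_tsub_eq_max]
    simp only [heq]
    have := ENNReal.Tendsto.sub (hint.add h1) (tendsto_const_nhds (x := ∫⁻ a, G a ∂μ))
      (Or.inr hGfin)
    simpa using this
  -- Since `h ≤ F + G ≤ 2G + (F - G)`, the part of `h` above `2G` is controlled by `h2`.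
  have h3 : Tendsto (fun k => ∫⁻ a, min (h k a) (2 * G a) ∂μ) atTop (𝓝 0) := by
    have := tendsto_lintegral_of_dominated_convergence (μ := μ)
      (F := fun k a => min (h k a) (2 * G a)) (f := fun _ => 0) (fun a => 2 * G a)
      (fun k => (hm k).min (hG.const_mul 2)) (fun k => ae_of_all _ fun a => min_le_right _ _)
      (by rw [lintegral_const_mul _ hG]; exact ENNReal.mul_ne_top ENNReal.ofNat_ne_top hGfin) ?_
    · simpa using this
    · filter_upwards [hlim] with a ha
      exact tendsto_of_tendsto_of_tendsto_of_le_of_le tendsto_const_nhds ha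
        (fun _ => zero_le) (fun _ => min_le_left _ _)
  have h4 := h3.add h2
  rw [add_zero] at h4
  refine tendsto_of_tendsto_of_tendsto_of_le_of_le tendsto_const_nhds h4 (fun _ => zero_le)
    fun k => ?_
  change ∫⁻ a, h k a ∂μ ≤ ∫⁻ a, min (h k a) (2 * G a) ∂μ + ∫⁻ a, (F k a - G a) ∂μ
  rw [← lintegral_add_left ((hm k).min (hG.const_mul 2))]
  refine lintegral_mono_ae ?_
  filter_upwards [hle k] with a ha
  rcases le_total (h k a) (2 * G a) with hc | hc
  · rw [min_eq_left hc]
    exact le_self_add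
  · rw [min_eq_right hc]
    calc h k a ≤ F k a + G a := ha
      _ ≤ (G a + (F k a - G a)) + G a := by gcongr; exact le_add_tsub
      _ = 2 * G a + (F k a - G a) := by ring

namespace LorentzPhi

variable {α : ℝ≥0∞} {φ : ℝ → ℝ}

/-- The Kadec–Klee property of `Λ_φ` for global convergence in measure. -/
lemma tendsto_lorentzNorm_sub (hconc : ConcaveOn ℝ (dom α) φ) (hmono : MonotoneOn φ (dom α))
    {y : ℕ → L0 α} {z : L0 α}
    (h : ∀ s, 0 < s → Tendsto (fun k => rearrangement (y k - z) s) atTop (𝓝 0))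
    (hz : lorentzNorm φ z < ∞)
    (hnorm : Tendsto (fun k => lorentzNorm φ (y k)) atTop (𝓝 (lorentzNorm φ z))) :
    Tendsto (fun k => lorentzNorm φ (y k - z)) atTop (𝓝 0) := by
  simp only [lorentzNorm_eq_dilated φ (_ - z)]
  have hmain : Tendsto (fun k => ∫⁻ s in dom α, dilatedIntegrand φ (y k - z) s) atTop (𝓝 0) := by
    refine tendsto_lintegral_zero_of_le_add (fun k => measurable_dilatedIntegrand φ _)
      (fun k => measurable_integrand φ (y k)) (measurable_integrand φ z) (fun k => ?_) ?_
      (ae_tendsto_integrand φ h) hz.ne hnorm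
    · exact (ae_dilatedIntegrand_le hconc hmono).mono fun s hs => hs _ _ _ (ae_abs_sub_le (y k) z)
    · filter_upwards [ae_dom_pos α] with s hs
      by_cases h2s : 2 * s ∈ dom α
      · simp only [dilatedIntegrand, Set.indicator_of_mem h2s, integrand]
        simpa using ENNReal.Tendsto.mul_const (b := ENNReal.ofReal (deriv φ (2 * s)))
          (h (2 * s) (by linarith)) (Or.inr ENNReal.ofReal_ne_top)
      · simp [dilatedIntegrand, Set.indicator_of_notMem h2s]
  simpa using ENNReal.Tendsto.const_mul (a := 2) hmain (Or.inr ENNReal.ofNat_ne_top)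

end LorentzPhi

end

theorem mainTheorem12 (α : ℝ≥0∞) (hα : α = 1 ∨ α = ∞) (φ : ℝ → ℝ)
    (hconc : ConcaveOn ℝ (LorentzPhi.dom α) φ) (hmono : MonotoneOn φ (LorentzPhi.dom α))
    (hzero : Tendsto φ (𝓝[>] (0 : ℝ)) (𝓝 0))
    (C : Set (LorentzPhi.L0 α)) (hCsub : C ⊆ LorentzPhi.lorentzSpace α φ)
    (hC : LorentzPhi.IsMuCompact C)
    (x : LorentzPhi.L0 α) (hx : x ∈ LorentzPhi.lorentzSpace α φ) (hxC : x ∉ C)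
    (c : ℕ → LorentzPhi.L0 α) (hcC : ∀ n, c n ∈ C)
    (hmin : Tendsto (fun n => LorentzPhi.lorentzNorm φ (x - c n)) atTop
      (𝓝 (LorentzPhi.lorentzDist φ x C))) :
    ∃ (n : ℕ → ℕ) (c' : LorentzPhi.L0 α), StrictMono n ∧
      c' ∈ LorentzPhi.bestApproximants φ C x ∧
      Tendsto (fun k => LorentzPhi.lorentzNorm φ (c (n k) - c')) atTop (𝓝 0) := by
  obtain ⟨n, c', hn, hc', hlim⟩ := hC.2 c hcC
  have hsub : ∀ k, (x - c (n k)) - (x - c') = c' - c (n k) := fun k => by abel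
  have hr : ∀ s, 0 < s → Tendsto
      (fun k => LorentzPhi.rearrangement ((x - c (n k)) - (x - c')) s) atTop (𝓝 0) := by
    intro s hs
    simp only [hsub, LorentzPhi.rearrangement_congr_abs (LorentzPhi.ae_abs_sub_comm c' _)]
    exact LorentzPhi.tendsto_rearrangement_sub_of_tendstoInMeasure hlim hs
  have hminn := hmin.comp hn.tendsto_atTop
  have hbest : LorentzPhi.lorentzNorm φ (x - c') = LorentzPhi.lorentzDist φ x C :=
    le_antisymm ((LorentzPhi.lorentzNorm_le_liminf φ hr).trans_eq hminn.liminf_eq)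
      (iInf₂_le c' hc')
  refine ⟨n, c', hn, ⟨hc', hbest⟩, ?_⟩
  have hfin := LorentzPhi.lorentzNorm_sub_lt_top hconc hmono hx (hCsub hc')
  rw [← hbest] at hminn
  have key := LorentzPhi.tendsto_lorentzNorm_sub hconc hmono hr hfin hminn
  refine key.congr fun k => ?_
  rw [hsub, LorentzPhi.lorentzNorm, LorentzPhi.lorentzNorm,
    LorentzPhi.rearrangement_congr_abs (LorentzPhi.ae_abs_sub_comm c' _)]
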